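/- For $n\in\mathbb N_0=\{0,1,2,\dots\}$ and real $a$ put $(a)_n=a(a+1)\cdots(a+n-1)$, $(a)_0=1$, and $\binom{n+a}{n}=\frac{(a+1)_n}{n!}$. For $\alpha,\beta>-1$ let $$P_n^{(\alpha,\beta)}(x)=\binom{n+\alpha}{n}\;{}_2F_1\!\left(-n,\,n+\alpha+\beta+1;\,\alpha+1;\,\tfrac{1-x}{2}\right)$$ be the Jacobi polynomials, and for real $x$, $\beta>0$ and $0<c<1$ let $M_n(x;\beta,c)={}_2F_1(-n,-x;\beta;1-c^{-1})$ be the Meixner polynomials (both hypergeometric series terminate). (a) For all $n\in\mathbb N_0$ and all real $\alpha,\beta$ with $\beta\ge 0$ and $\alpha\ge\beta-\lfloor\beta\rfloor$, $$\left(\frac{1+x}{2}\right)^{\beta/2}\bigl|P_n^{(\alpha,\beta)}(x)\bigr|\le\binom{n+\alpha}{n},\qquad x\in[-1,1]$$ (with $0^0=1$). (b) For all $n\in\mathbb N_0$ and all real $x,\beta,c$ with $x\ge n$, $0<c<1$ and $\beta\ge x-\lfloor x\rfloor+1$, $$c^{(n+x)/2}\,|M_n(x;\beta,c)|\le 1.$$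 (c) The inequalities in (a) and (b) are equivalent: for all $n\in\mathbb N_0$, $\alpha>-1$ and $\beta\ge0$, the inequality in (a) holds for all $x\in[-1,1]$ if and only if $c^{(2n+\beta)/2}\,|M_n(n+\beta;\alpha+1,c)|\le1$ for all $c\in(0,1)$. -/

import Mathlib

/-- The generalized binomial coefficient `binom (n + a) n = (a + 1)_n / n!`, where
`(a + 1)_n = (a + 1) (a + 2) ⋯ (a + n)` is the Pochhammer symbol (rising factorial). -/
noncomputable def shiftedBinomial (n : ℕ) (a : ℝ) : ℝ :=
  (ascPochhammer ℝ n).eval (a + 1) / (n.factorial : ℝ)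

/-- The Jacobi polynomial `P_n^{(α,β)}` as a function of its real argument, given for `α > -1` by
`P_n^{(α,β)}(x) = binom (n + α) n * ₂F₁(-n, n + α + β + 1; α + 1; (1 - x) / 2)`.
The hypergeometric series terminates, and the value at `x = 1` is `binom (n + α) n`. -/
noncomputable def jacobiP (n : ℕ) (α β x : ℝ) : ℝ :=
  shiftedBinomial n α *
    ordinaryHypergeometric (-(n : ℝ)) ((n : ℝ) + α + β + 1) (α + 1) ((1 - x) / 2)

/-- The Meixner polynomial `M_n(x; β, c) = ₂F₁(-n, -x; β; 1 - c⁻¹)`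
(a terminating series), for `β > 0` and `c ≠ 0`. -/
noncomputable def meixnerM (n : ℕ) (x β c : ℝ) : ℝ :=
  ordinaryHypergeometric (-(n : ℝ)) (-x) β (1 - c⁻¹)

open Polynomial

/-! Put `z = (1 - x) / 2`, let `J_n` be the monic Jacobi polynomial in `z`, and write `β = m + t`
with `m = ⌊β⌋`. Since `(-1)^n J_n` is a positive multiple of `P_n`, the bound with the larger weight
`(1 - z)^(m/2)` says that `D_n = (-1)^n (J_n(0) + w J_n(z))` is nonnegative for both `w = ±(1 -
z)^(m/2)`. This nonnegativity is proved at one parameter point and then transported through the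
parameter plane.

At `(α, β) = (0, m)` the weighted polynomial is a diagonal matrix entry of a plane rotation acting
on binary forms of degree `2n + m`. The action is orthogonal for the binomially weighted inner
product, so the entry is at most 1 in absolute value (`pow_mul_abs_bernsteinJacobi_le`).

Differentiating the Jacobi equation in the parameters gives `J_n' = ∑_{k<n} f_{nk} J_k` along any
direction (`hasDerivAt_eval_monicJacobi`). For direction `(1, 1)` in the region `a ≤ b`, and for
direction `(1, 0)`, one has `(-1)^(n-k) f_{nk} ≥ 0`. Hence `D_n' = ∑ (nonnegative) D_k`, and
induction on `n` preserves `D_n ≥ 0` (`monicJacobi_flow_nonneg`). The path runs from `(0, m)` to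
`(t, m + t)` and then to `(α, m + t)`, which is where `α ≥ t` enters.

The Meixner statements follow by setting `c = 1 - z = (1 + x) / 2`: multiplied by `c^n`, the Meixner
sum becomes the Bernstein form of the Jacobi polynomial term by term (`meixnerM_eq`). -/

/-- The rising factorial `x (x + 1) ⋯ (x + n - 1)`. -/
noncomputable def rising (x : ℝ) (n : ℕ) : ℝ := (ascPochhammer ℝ n).eval x

@[simp] lemma rising_zero (x : ℝ) : rising x 0 = 1 := by simp [rising]

lemma rising_succ (x : ℝ) (n : ℕ) : rising x (n + 1) = rising x n * (x + n) := by
  simp [rising, ascPochhammer_succ_eval]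

lemma rising_succ_left (x : ℝ) (n : ℕ) : rising x (n + 1) = x * rising (x + 1) n := by
  simp [rising, ascPochhammer_succ_left]

lemma rising_add (x : ℝ) (m n : ℕ) : rising x (m + n) = rising x m * rising (x + m) n := by
  induction n with
  | zero => simp
  | succ n ih => rw [← add_assoc, rising_succ, ih, rising_succ]; push_cast; ring

lemma rising_pos {x : ℝ} (hx : 0 < x) (n : ℕ) : 0 < rising x n := ascPochhammer_pos n x hx

lemma rising_le_rising {x y : ℝ} (hx : 0 < x) (hxy : x ≤ y) (n : ℕ) :
    rising x n ≤ rising y n := by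
  induction n with
  | zero => simp
  | succ n ih =>
    rw [rising_succ, rising_succ]
    have := (rising_pos hx n).le
    gcongr
    exact this.trans ih

lemma rising_natCast_succ (k n : ℕ) : rising ((k : ℝ) + 1) n * k.factorial = (k + n).factorial := by
  induction n with
  | zero => simp
  | succ n ih =>
    rw [rising_succ, ← add_assoc, Nat.factorial_succ]
    push_cast
    rw [← ih]
    ring

/-! ### The Jacobi equation and two forms of its polynomial solution -/

/-- The differential operator `z (1 - z) D² + (a + 1 - (a + b + 2) z) D`. -/
noncomputable def jacobiOp (a b : ℝ) (p : ℝ[X]) : ℝ[X] :=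
  X * (1 - X) * derivative (derivative p) + (C (a + 1) - C (a + b + 2) * X) * derivative p

lemma jacobiOp_coeff (a b : ℝ) (p : ℝ[X]) (j : ℕ) :
    (jacobiOp a b p).coeff j =
      -(j * (j + a + b + 1)) * p.coeff j + (j + 1) * (j + 1 + a) * p.coeff (j + 1) := by
  have h : jacobiOp a b p = X * derivative (derivative p) - X * (X * derivative (derivative p))
      + C (a + 1) * derivative p - C (a + b + 2) * (X * derivative p) := by
    unfold jacobiOp; ring
  rw [h]
  rcases j with _ | _ | j
  · simp only [coeff_add, coeff_sub, coeff_C_mul, coeff_X_mul_zero, coeff_derivative]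
    push_cast; ring
  · simp only [coeff_add, coeff_sub, coeff_C_mul, coeff_X_mul, coeff_X_mul_zero, coeff_derivative]
    push_cast; ring
  · simp only [coeff_add, coeff_sub, coeff_C_mul, coeff_X_mul, coeff_derivative]
    push_cast; ring

lemma jacobiOp_add (a b : ℝ) (p q : ℝ[X]) :
    jacobiOp a b (p + q) = jacobiOp a b p + jacobiOp a b q := by
  simp only [jacobiOp, derivative_add]; ring

lemma jacobiOp_C_mul (a b c : ℝ) (p : ℝ[X]) :
    jacobiOp a b (C c * p) = C c * jacobiOp a b p := by
  simp only [jacobiOp, derivative_C_mul]; ring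

lemma jacobiOp_sum {ι : Type*} (a b : ℝ) (s : Finset ι) (p : ι → ℝ[X]) :
    jacobiOp a b (∑ i ∈ s, p i) = ∑ i ∈ s, jacobiOp a b (p i) := by
  simp only [jacobiOp, derivative_sum, Finset.mul_sum, Finset.sum_add_distrib]

/-- The equation is a two-term recursion on coefficients whose factor `(j + 1) (j + 1 + a)` never
vanishes for `a > -1`, so the constant term determines the solution. -/
lemma eq_zero_of_jacobiOp {a b l : ℝ} (ha : -1 < a) {p : ℝ[X]}
    (hp : jacobiOp a b p + C l * p = 0) (h0 : p.coeff 0 = 0) : p = 0 := by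
  ext j
  induction j with
  | zero => simpa using h0
  | succ j ih =>
    have h := congrArg (fun q => q.coeff j) hp
    simp only [coeff_add, jacobiOp_coeff, coeff_C_mul, ih, coeff_zero, mul_zero, zero_add,
      add_zero] at h
    have : (0 : ℝ) < (j + 1) * (j + 1 + a) := by
      have : (0 : ℝ) ≤ j := j.cast_nonneg
      have : 0 < (j : ℝ) + 1 + a := by linarith
      positivity
    simpa using (mul_eq_zero.mp h).resolve_left this.ne'

/-- The coefficient of `z ^ j` in the monic Jacobi polynomial of degree `n`, `s = a + b + 1`. -/
noncomputable def monicCoeff (n j : ℕ) (a s : ℝ) : ℝ :=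
  (-1) ^ (n - j) * n.choose j * rising (a + j + 1) (n - j) / rising (n + s + j) (n - j)

lemma monicCoeff_self (n : ℕ) (a s : ℝ) : monicCoeff n n a s = 1 := by simp [monicCoeff]

lemma monicCoeff_of_lt {n j : ℕ} (h : n < j) (a s : ℝ) : monicCoeff n j a s = 0 := by
  simp [monicCoeff, Nat.choose_eq_zero_of_lt h]

lemma monicCoeff_rec (n j : ℕ) (a : ℝ) {s : ℝ} (hs : 0 < s) :
    ((n : ℝ) - j) * (n + j + s) * monicCoeff n j a s
      + (j + 1) * (j + 1 + a) * monicCoeff n (j + 1) a s = 0 := by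
  rcases lt_trichotomy n j with h | rfl | h
  · simp [monicCoeff_of_lt h, monicCoeff_of_lt (h.trans j.lt_succ_self)]
  · simp [monicCoeff_of_lt n.lt_succ_self]
  · obtain ⟨i, rfl⟩ := Nat.exists_eq_add_of_lt h
    have e1 : j + i + 1 - j = i + 1 := by omega
    have e2 : j + i + 1 - (j + 1) = i := by omega
    have hc : ((j + i + 1).choose (j + 1) : ℝ) * (j + 1) = (j + i + 1).choose j * (i + 1) := by
      have := Nat.choose_succ_right_eq (j + i + 1) j
      rw [e1] at this
      exact_mod_cast this
    simp only [monicCoeff, e1, e2]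
    rw [rising_succ_left, rising_succ_left (((j + i + 1 : ℕ) : ℝ) + s + j)]
    have h1 : 0 < rising (((j + i + 1 : ℕ) : ℝ) + s + j + 1) i := rising_pos (by positivity) _
    have h2 : 0 < ((j + i + 1 : ℕ) : ℝ) + s + j := by positivity
    have e3 : ((j + i + 1 : ℕ) : ℝ) + s + ((j + 1 : ℕ) : ℝ) = ((j + i + 1 : ℕ) : ℝ) + s + j + 1 := by
      push_cast; ring
    have e4 : a + ((j + 1 : ℕ) : ℝ) + 1 = a + j + 1 + 1 := by push_cast; ring
    rw [e3, e4]
    have e5 : ((j + i + 1 : ℕ) : ℝ) + j + s = ((j + i + 1 : ℕ) : ℝ) + s + j := by ring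
    rw [e5]
    field_simp
    have e6 : ((j + i + 1 : ℕ) : ℝ) - j = i + 1 := by push_cast; ring
    rw [e6]
    linear_combination (-1 : ℝ) ^ i * (1 + j + a) * rising (a + j + 1 + 1) i * hc

/-- The monic polynomial proportional to the Jacobi polynomial of degree `n` in `z = (1 - x) / 2`. -/
noncomputable def monicJacobi (n : ℕ) (a b : ℝ) : ℝ[X] :=
  ∑ j ∈ Finset.range (n + 1), C (monicCoeff n j a (a + b + 1)) * X ^ j

lemma monicJacobi_coeff (n j : ℕ) (a b : ℝ) :
    (monicJacobi n a b).coeff j = monicCoeff n j a (a + b + 1) := by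
  simp only [monicJacobi, finsetSum_coeff, coeff_C_mul, coeff_X_pow]
  by_cases h : n < j
  · rw [monicCoeff_of_lt h, Finset.sum_eq_zero]
    intro i hi
    have : j ≠ i := by simp at hi; omega
    simp [this]
  · rw [Finset.sum_eq_single j] <;> simp +contextual
    · intro b _ hb; exact fun h => absurd h.symm hb
    · omega

lemma jacobiOp_monicJacobi (n : ℕ) {a b : ℝ} (hs : 0 < a + b + 1) :
    jacobiOp a b (monicJacobi n a b) + C ((n : ℝ) * (n + (a + b + 1))) * monicJacobi n a b = 0 := by
  ext j
  rw [coeff_add, jacobiOp_coeff, coeff_C_mul, monicJacobi_coeff, monicJacobi_coeff, coeff_zero]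
  linear_combination monicCoeff_rec n j a hs

/-- The coefficients of the Jacobi polynomial (times `n!`) in the Bernstein basis. -/
noncomputable def bernsteinCoeff (n k : ℕ) (a b : ℝ) : ℝ :=
  (-1) ^ k * n.choose k * rising (a + k + 1) (n - k) * rising (b + (n - k : ℕ) + 1) k

/-- `n!` times the Jacobi polynomial as a polynomial in `z = (1 - x) / 2`. -/
noncomputable def bernsteinJacobi (n : ℕ) (a b : ℝ) : ℝ[X] :=
  ∑ k ∈ Finset.range (n + 1), C (bernsteinCoeff n k a b) * (X ^ k * (1 - X) ^ (n - k))

lemma bernsteinCoeff_rec (k l : ℕ) (a b : ℝ) :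
    (k + 1) * (k + 1 + a) * bernsteinCoeff (k + 1 + l) (k + 1) a b
      = -((l + 1) * (l + 1 + b)) * bernsteinCoeff (k + 1 + l) k a b := by
  have e1 : k + 1 + l - k = l + 1 := by omega
  have e2 : k + 1 + l - (k + 1) = l := by omega
  have hc : ((k + 1 + l).choose (k + 1) : ℝ) * (k + 1) = (k + 1 + l).choose k * (l + 1) := by
    have := Nat.choose_succ_right_eq (k + 1 + l) k
    rw [e1] at this
    exact_mod_cast this
  simp only [bernsteinCoeff, e1, e2]
  rw [rising_succ_left, rising_succ_left (a + k + 1)]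
  have e3 : a + ((k + 1 : ℕ) : ℝ) + 1 = a + k + 1 + 1 := by push_cast; ring
  have e4 : b + ((l + 1 : ℕ) : ℝ) + 1 = b + l + 1 + 1 := by push_cast; ring
  rw [e3, e4, pow_succ]
  linear_combination -((-1 : ℝ) ^ k * (k + 1 + a) * rising (a + k + 1 + 1) l * (b + l + 1)
    * rising (b + l + 1 + 1) k) * hc

lemma bernsteinCoeff_reflect (k l : ℕ) (a b : ℝ) :
    bernsteinCoeff (k + l) k a b = (-1) ^ (k + l) * bernsteinCoeff (k + l) l b a := by
  have hc : (k + l).choose l = (k + l).choose k := by rw [Nat.choose_symm_add]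
  simp only [bernsteinCoeff, Nat.add_sub_cancel_left, Nat.add_sub_cancel, hc]
  have : ((-1 : ℝ) ^ l) * (-1) ^ l = 1 := by rw [← mul_pow]; simp
  rw [pow_add]
  linear_combination -((-1 : ℝ) ^ k * (k + l).choose k * rising (a + k + 1) l
    * rising (b + l + 1) k) * this

lemma bernsteinJacobi_comp (n : ℕ) (a b : ℝ) :
    (bernsteinJacobi n a b).comp (1 - X) = C ((-1) ^ n) * bernsteinJacobi n b a := by
  rw [bernsteinJacobi, bernsteinJacobi, Finset.mul_sum, ← Finset.sum_range_reflect, Polynomial.sum_comp]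
  refine Finset.sum_congr rfl fun k hk => ?_
  obtain ⟨l, rfl⟩ := Nat.exists_eq_add_of_le (Nat.lt_succ_iff.mp (Finset.mem_range.mp hk))
  have e1 : k + l + 1 - 1 - k = l := by omega
  have e2 : k + l - l = k := by omega
  have e3 : k + l - k = l := by omega
  have h := bernsteinCoeff_reflect l k a b
  rw [add_comm l k] at h
  simp only [e1, e2, e3, h, mul_comp, C_comp, pow_comp, X_comp, sub_comp, one_comp, C_mul]
  rw [sub_sub_cancel]
  ring

lemma bernsteinJacobi_coeff_zero (n : ℕ) (a b : ℝ) :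
    (bernsteinJacobi n a b).coeff 0 = rising (a + 1) n := by
  rw [coeff_zero_eq_eval_zero, bernsteinJacobi, eval_finsetSum, Finset.sum_eq_single 0]
  · simp [bernsteinCoeff]
  · intro k _ hk; simp [hk]
  · simp

lemma jacobiOp_X_pow_mul (k l : ℕ) (a b : ℝ) :
    jacobiOp a b (X ^ k * (1 - X) ^ l)
        + C (((k : ℝ) + l) * (k + l + (a + b + 1))) * (X ^ k * (1 - X) ^ l) =
      C (k * (k + a)) * (X ^ (k - 1) * (1 - X) ^ (l + 1) + X ^ k * (1 - X) ^ l)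
        + C (l * (l + b)) * (X ^ k * (1 - X) ^ l + X ^ (k + 1) * (1 - X) ^ (l - 1)) := by
  -- The truncated exponents `k - 1` and `l - 1` are harmless: their coefficients vanish at `k = 0`
  -- and `l = 0`.
  have h2 : (C 2 : ℝ[X]) = 2 := rfl
  rcases k with _ | _ | k <;> rcases l with _ | _ | l <;>
  · simp [jacobiOp, derivative_pow, h2]
    try ring

lemma jacobiOp_bernsteinJacobi (n : ℕ) (a b : ℝ) :
    jacobiOp a b (bernsteinJacobi n a b)
      + C ((n : ℝ) * (n + (a + b + 1))) * bernsteinJacobi n a b = 0 := by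
  set u : ℕ → ℝ[X] := fun k => C (bernsteinCoeff n k a b) * (C (k * (k + a)) *
    (X ^ (k - 1) * (1 - X) ^ (n - k + 1) + X ^ k * (1 - X) ^ (n - k))) with hu
  set v : ℕ → ℝ[X] := fun k => C (bernsteinCoeff n k a b) * (C ((n - k : ℕ) * ((n - k : ℕ) + b)) *
    (X ^ k * (1 - X) ^ (n - k) + X ^ (k + 1) * (1 - X) ^ (n - k - 1))) with hv
  have h : jacobiOp a b (bernsteinJacobi n a b)
      + C ((n : ℝ) * (n + (a + b + 1))) * bernsteinJacobi n a b =
        ∑ k ∈ Finset.range (n + 1), u k + ∑ k ∈ Finset.range (n + 1), v k := by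
    rw [bernsteinJacobi, jacobiOp_sum, Finset.mul_sum, ← Finset.sum_add_distrib,
      ← Finset.sum_add_distrib]
    refine Finset.sum_congr rfl fun k hk => ?_
    have hk : k ≤ n := Nat.lt_succ_iff.mp (Finset.mem_range.mp hk)
    have e := jacobiOp_X_pow_mul k (n - k) a b
    have hn : (k : ℝ) + (n - k : ℕ) = n := by push_cast [hk]; ring
    rw [hn] at e
    rw [jacobiOp_C_mul, hu, hv]
    linear_combination C (bernsteinCoeff n k a b) * e
  -- The total telescopes: `u (k + 1)` cancels `v k` by `bernsteinCoeff_rec`, and the end terms `u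
  -- 0` and `v n` vanish.
  rw [h, Finset.sum_range_succ', Finset.sum_range_succ v]
  have h0 : u 0 = 0 := by simp [hu]
  have h1 : v n = 0 := by simp [hv]
  rw [h0, h1, add_zero, add_zero, ← Finset.sum_add_distrib]
  refine Finset.sum_eq_zero fun k hk => ?_
  obtain ⟨l, rfl⟩ := Nat.exists_eq_add_of_lt (Finset.mem_range.mp hk)
  have hr := bernsteinCoeff_rec k l a b
  have e0 : k + l + 1 = k + 1 + l := by ring
  have e1 : k + 1 + l - k = l + 1 := by omega
  have e2 : k + 1 + l - (k + 1) = l := by omega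
  simp only [hu, hv, e0, e1, e2, Nat.add_sub_cancel]
  rw [← mul_assoc, ← mul_assoc, ← C_mul, ← C_mul]
  have hr' : bernsteinCoeff (k + 1 + l) (k + 1) a b * (((k + 1 : ℕ) : ℝ) * ((k + 1 : ℕ) + a))
      = -(bernsteinCoeff (k + 1 + l) k a b * (((l + 1 : ℕ) : ℝ) * ((l + 1 : ℕ) + b))) := by
    push_cast
    linear_combination hr
  rw [hr', C_neg]
  ring

/-- Both sides solve the Jacobi equation with the same eigenvalue, so comparing constant terms
suffices. The monic form suits parameter derivatives; the Bernstein form makes the reflection `z ↦ 1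
- z`, the rotation coefficients and the Meixner sum visible. -/
lemma bernsteinJacobi_eq (n : ℕ) {a b : ℝ} (ha : -1 < a) (hs : 0 < a + b + 1) :
    bernsteinJacobi n a b = C ((-1) ^ n * rising (n + (a + b + 1)) n) * monicJacobi n a b := by
  rw [← sub_eq_zero]
  have h1 := jacobiOp_monicJacobi n hs
  have h2 := jacobiOp_bernsteinJacobi n a b
  set c := (-1) ^ n * rising (n + (a + b + 1)) n with hc
  refine eq_zero_of_jacobiOp (b := b) (l := (n : ℝ) * (n + (a + b + 1))) ha ?_ ?_
  · have : bernsteinJacobi n a b - C c * monicJacobi n a b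
        = bernsteinJacobi n a b + C (-c) * monicJacobi n a b := by rw [C_neg]; ring
    rw [this, jacobiOp_add, jacobiOp_C_mul, C_neg]
    linear_combination h2 - C c * h1
  · rw [coeff_sub, coeff_C_mul, bernsteinJacobi_coeff_zero, monicJacobi_coeff, hc, monicCoeff]
    have : 0 < rising (n + (a + b + 1)) n := rising_pos (by positivity) n
    have h3 : ((-1 : ℝ) ^ n) * (-1) ^ n = 1 := by rw [← mul_pow]; simp
    simp only [Nat.sub_zero, Nat.choose_zero_right, Nat.cast_zero, add_zero, Nat.cast_one, mul_one]
    field_simp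
    linear_combination -rising (a + 1) n * h3

lemma monicJacobi_comp (n : ℕ) {a b : ℝ} (ha : -1 < a) (hb : -1 < b) (hs : 0 < a + b + 1) :
    (monicJacobi n a b).comp (1 - X) = C ((-1) ^ n) * monicJacobi n b a := by
  have h := bernsteinJacobi_comp n a b
  have hs' : 0 < b + a + 1 := by linarith
  have e : b + a + 1 = a + b + 1 := by ring
  rw [bernsteinJacobi_eq n ha hs, bernsteinJacobi_eq n hb hs', e, mul_comp, C_comp,
    mul_left_comm] at h
  refine mul_left_cancel₀ ?_ h
  have : 0 < rising (n + (a + b + 1)) n := rising_pos (by positivity) n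
  rw [Ne, C_eq_zero]
  exact mul_ne_zero (by simp) this.ne'

/-! ### Positive expansions of first-order operators applied to `J_n` -/

/-- The coefficients of `z J_n' - n J_n` in the basis of monic Jacobi polynomials `J_k`. -/
noncomputable def eulerCoeff (n k : ℕ) (a s : ℝ) : ℝ :=
  n.factorial / k.factorial * rising (a + k + 1) (n - k) /
    rising (s + 2 * k + 1) (2 * (n - k) - 1)

lemma eulerCoeff_nonneg (n k : ℕ) {a s : ℝ} (ha : -1 < a) (hs : 0 < s) :
    0 ≤ eulerCoeff n k a s := by
  have h1 : 0 < rising (a + k + 1) (n - k) :=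
    rising_pos (by have : (0 : ℝ) ≤ k := k.cast_nonneg
                   linarith) _
  have h2 : 0 < rising (s + 2 * k + 1) (2 * (n - k) - 1) := rising_pos (by positivity) _
  unfold eulerCoeff
  positivity

/-- With `s` held fixed only the numerator depends on `a`. This is the right comparison, because `s
= a + b + 1` is unchanged when `a` and `b` are swapped. -/
lemma eulerCoeff_mono (n k : ℕ) {a b s : ℝ} (ha : -1 < a) (hab : a ≤ b) (hs : 0 < s) :
    eulerCoeff n k a s ≤ eulerCoeff n k b s := by
  have h2 : 0 < rising (s + 2 * k + 1) (2 * (n - k) - 1) := rising_pos (by positivity) _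
  unfold eulerCoeff
  have := rising_le_rising (x := a + k + 1) (y := b + k + 1)
    (by have : (0 : ℝ) ≤ k := k.cast_nonneg
        linarith) (by linarith) (n - k)
  gcongr

lemma eulerCoeff_mul_monicCoeff (j i q : ℕ) (a s : ℝ) :
    eulerCoeff (j + i + 1 + q) (j + i) a s * monicCoeff (j + i) j a s =
      (j + i + 1 + q).factorial / j.factorial * rising (a + j + 1) (i + 1 + q) *
        ((-1) ^ i / (i.factorial *
          (rising (s + 2 * j + 2 * i + 1) (2 * q + 1) * rising (s + 2 * j + i) i))) := by
  have e1 : j + i + 1 + q - (j + i) = 1 + q := by omega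
  have e2 : j + i - j = i := by omega
  have e3 : 2 * (1 + q) - 1 = 2 * q + 1 := by omega
  have e4 : ((j + i : ℕ) : ℝ) + s + j = s + 2 * j + i := by push_cast; ring
  have e5 : s + 2 * ((j + i : ℕ) : ℝ) + 1 = s + 2 * j + 2 * i + 1 := by push_cast; ring
  have e6 : a + ((j + i : ℕ) : ℝ) + 1 = a + j + 1 + i := by push_cast; ring
  have hc : ((j + i).choose j : ℝ) = (j + i).factorial / (j.factorial * i.factorial) := by
    rw [Nat.cast_choose ℝ (Nat.le_add_right j i), e2]
  simp only [eulerCoeff, monicCoeff, e1, e2, e3, e4, e5, e6, hc]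
  rw [add_assoc i 1 q, rising_add (a + j + 1)]
  have h1 : ((j + i).factorial : ℝ) ≠ 0 := by positivity
  have h2 : (i.factorial : ℝ) ≠ 0 := by positivity
  have h3 : (j.factorial : ℝ) ≠ 0 := by positivity
  generalize rising (s + 2 * j + 2 * i + 1) (2 * q + 1) = A
  generalize rising (s + 2 * j + i) i = B
  generalize rising (a + j + 1) i = E
  generalize rising (a + j + 1 + i) (1 + q) = F
  simp only [div_eq_mul_inv, mul_inv]
  field_simp

/-- Every partial sum has a closed form, which lets induction on the cutoff `I` work; the
application is the full sum `I = N - 1`. -/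
lemma sum_eulerCoeff_mul_monicCoeff (j N I : ℕ) (a : ℝ) {s : ℝ} (hs : 0 < s) (h : I < N) :
    ∑ k ∈ Finset.range (j + I + 1), eulerCoeff (j + N) k a s * monicCoeff k j a s =
      (j + N).factorial / j.factorial * rising (a + j + 1) N *
        ((-1) ^ I / (I.factorial * rising (s + 2 * j + I + 1) (2 * N - I - 1))) := by
  induction I with
  | zero =>
    rw [Finset.sum_range_succ, Finset.sum_eq_zero, zero_add]
    · rw [monicCoeff_self, eulerCoeff, Nat.add_sub_cancel_left]
      simp
      ring
    · intro k hk
      rw [monicCoeff_of_lt (by simpa using hk), mul_zero]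
  | succ I ih =>
    have hI := ih (by omega)
    rw [add_assoc j I 1] at hI
    rw [Finset.sum_range_succ, hI]
    obtain ⟨q, rfl⟩ := Nat.exists_eq_add_of_lt h
    have e0 : j + (I + 1 + q + 1) = j + (I + 1) + 1 + q := by ring
    have e1 : I + 1 + q + 1 = I + 1 + 1 + q := by ring
    have e2 : 2 * (I + 1 + 1 + q) - I - 1 = I + 1 + (2 * q + 1 + 1) := by omega
    have e3 : 2 * (I + 1 + 1 + q) - (I + 1) - 1 = I + 1 + (2 * q + 1) := by omega
    rw [e0, eulerCoeff_mul_monicCoeff, e1, e2, e3, ← mul_add]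
    congr 1
    have e4 : s + 2 * j + I + 1 = s + 2 * j + ((I + 1 : ℕ) : ℝ) := by push_cast; ring
    rw [e4]
    set i := I + 1 with hi
    set x := s + 2 * (j : ℝ) + (i : ℝ) with hx
    have hxp : 0 < x := by positivity
    have k1 : rising x (i + (2 * q + 1 + 1)) =
        rising x i * ((x + i) * rising (s + 2 * j + 2 * i + 1) (2 * q + 1)) := by
      rw [rising_add, rising_succ_left (x + i)]
      congr 4
      rw [hx]; ring
    have k2 : rising x (i + (2 * q + 1 + 1)) = x * rising (x + 1) (i + (2 * q + 1)) := by
      rw [← rising_succ_left]; rfl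
    have k3 : rising (x + 1) (i + (2 * q + 1)) =
        rising x i * ((x + i) * rising (s + 2 * j + 2 * i + 1) (2 * q + 1)) / x := by
      rw [← k1, k2]; field_simp
    rw [k1, k3, hi, Nat.factorial_succ, pow_succ, ← hi]
    have p1 : 0 < rising x i := rising_pos hxp _
    have p2 : 0 < rising (s + 2 * j + 2 * i + 1) (2 * q + 1) := rising_pos (by positivity) _
    have p3 : 0 < x + i := by positivity
    have p4 : (I.factorial : ℝ) ≠ 0 := by positivity
    have p5 : (i : ℝ) ≠ 0 := by positivity
    have p6 : ((I + 1 : ℕ) : ℝ) = i := rfl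
    rw [Nat.cast_mul, p6]
    field_simp
    ring

lemma X_mul_derivative_monicJacobi (n : ℕ) {a b : ℝ} (hs : 0 < a + b + 1) :
    X * derivative (monicJacobi n a b) - C (n : ℝ) * monicJacobi n a b =
      ∑ k ∈ Finset.range n, C (eulerCoeff n k a (a + b + 1)) * monicJacobi k a b := by
  ext j
  simp only [finsetSum_coeff, coeff_sub, coeff_C_mul, monicJacobi_coeff]
  have hX : (X * derivative (monicJacobi n a b)).coeff j = j * monicCoeff n j a (a + b + 1) := by
    rcases j with _ | j
    · simp
    · rw [coeff_X_mul, coeff_derivative, monicJacobi_coeff]; push_cast; ring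
  rw [hX]
  rcases lt_or_ge j n with h | h
  · obtain ⟨I, rfl⟩ := Nat.exists_eq_add_of_lt h
    have hh := sum_eulerCoeff_mul_monicCoeff j (I + 1) I a hs I.lt_succ_self
    rw [← add_assoc] at hh
    rw [hh]
    have e1 : j + I + 1 - j = I + 1 := by omega
    have e2 : 2 * (I + 1) - I - 1 = I + 1 := by omega
    have e3 : ((j + I + 1 : ℕ) : ℝ) + (a + b + 1) + j = a + b + 1 + 2 * j + I + 1 := by
      push_cast; ring
    rw [monicCoeff, e1, e2, e3, Nat.cast_choose ℝ h.le, e1, Nat.factorial_succ I]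
    have p : 0 < rising (a + b + 1 + 2 * j + I + 1) (I + 1) := rising_pos (by positivity) _
    have p1 : (I.factorial : ℝ) ≠ 0 := by positivity
    have p2 : (j.factorial : ℝ) ≠ 0 := by positivity
    push_cast
    field_simp
    ring
  · rw [Finset.sum_eq_zero]
    · rcases h.eq_or_lt with rfl | h
      · ring
      · rw [monicCoeff_of_lt h]; ring
    · intro k hk
      rw [monicCoeff_of_lt ((Finset.mem_range.mp hk).trans_le h), mul_zero]

/-- The reflection `z ↦ 1 - z` exchanges `a` and `b` and multiplies `J_k` by `(-1)^k`, so this is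
the previous expansion reflected. -/
lemma X_sub_one_mul_derivative_monicJacobi (n : ℕ) {a b : ℝ} (ha : -1 < a) (hb : -1 < b)
    (hs : 0 < a + b + 1) :
    (X - 1) * derivative (monicJacobi n a b) - C (n : ℝ) * monicJacobi n a b =
      ∑ k ∈ Finset.range n,
        C ((-1) ^ (n - k) * eulerCoeff n k b (a + b + 1)) * monicJacobi k a b := by
  have hs' : 0 < b + a + 1 := by linarith
  have e : b + a + 1 = a + b + 1 := by ring
  have h := congrArg (fun p => C ((-1 : ℝ) ^ n) * p.comp (1 - X))
    (X_mul_derivative_monicJacobi n hs')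
  have hd : (derivative (monicJacobi n b a)).comp (1 - X)
      = - (C ((-1 : ℝ) ^ n) * derivative (monicJacobi n a b)) := by
    have := congrArg derivative (monicJacobi_comp n hb ha hs')
    rw [derivative_comp, derivative_C_mul] at this
    simp only [derivative_sub, derivative_one, derivative_X] at this
    linear_combination -this
  have hsq : (C ((-1 : ℝ) ^ n)) * C ((-1 : ℝ) ^ n) = 1 := by
    rw [← C_mul, ← mul_pow]; simp
  simp only [sub_comp, mul_comp, X_comp, C_comp, Polynomial.sum_comp, hd,
    monicJacobi_comp _ hb ha hs', e] at h
  have h2 : (X - 1) * derivative (monicJacobi n a b) - C (n : ℝ) * monicJacobi n a b =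
      C ((-1 : ℝ) ^ n) * ∑ k ∈ Finset.range n,
        C (eulerCoeff n k b (a + b + 1)) * (C ((-1) ^ k) * monicJacobi k a b) := by
    rw [← h]
    linear_combination (-((X - 1) * derivative (monicJacobi n a b)
      - C (n : ℝ) * monicJacobi n a b)) * hsq
  rw [h2, Finset.mul_sum]
  refine Finset.sum_congr rfl fun k hk => ?_
  obtain ⟨i, rfl⟩ := Nat.exists_eq_add_of_lt (Finset.mem_range.mp hk)
  have e1 : k + i + 1 - k = i + 1 := by omega
  have hk2 : ((-1 : ℝ)) ^ (k + i + 1) * (-1) ^ k = (-1) ^ (i + 1) := by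
    have : ((-1 : ℝ) ^ k) * (-1) ^ k = 1 := by rw [← mul_pow]; simp
    rw [add_assoc, pow_add]
    linear_combination (-1) ^ (i + 1) * this
  rw [e1, ← hk2]
  simp only [C_mul]
  ring

/-! ### Flow in the parameters and its sign -/

/-- The coefficients of the directional derivative of `J_n` with respect to the parameters. -/
noncomputable def flowCoeff (n k : ℕ) (a b da db : ℝ) : ℝ :=
  (db * eulerCoeff n k a (a + b + 1) + da * ((-1) ^ (n - k) * eulerCoeff n k b (a + b + 1))) /
    ((n - k) * (n + k + (a + b + 1)))

/-- This is the `z^j` coefficient of the Jacobi equation differentiated in the parameters. The right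
side is `da ((z - 1) D - n) J_n + db (z D - n) J_n`; on `J_k` the operator plus the eigenvalue for
`n` acts as the eigenvalue difference `(n - k) (n + k + s)`, which is the denominator of
`flowCoeff`. -/
lemma sum_flowCoeff_mul_rec (n j : ℕ) {a b : ℝ} (da db : ℝ) (ha : -1 < a) (hb : -1 < b)
    (hs : 0 < a + b + 1) :
    ((n : ℝ) - j) * (n + j + (a + b + 1)) *
        ∑ k ∈ Finset.range n, flowCoeff n k a b da db * monicCoeff k j a (a + b + 1)
      + (j + 1) * (j + 1 + a) *
        ∑ k ∈ Finset.range n, flowCoeff n k a b da db * monicCoeff k (j + 1) a (a + b + 1) =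
    (da + db) * (((j : ℝ) - n) * monicCoeff n j a (a + b + 1))
      - da * ((j + 1) * monicCoeff n (j + 1) a (a + b + 1)) := by
  have h1 := congrArg (fun p => p.coeff j) (X_mul_derivative_monicJacobi n hs)
  have h2 := congrArg (fun p => p.coeff j) (X_sub_one_mul_derivative_monicJacobi n ha hb hs)
  have hX : (X * derivative (monicJacobi n a b)).coeff j = j * monicCoeff n j a (a + b + 1) := by
    rcases j with _ | j
    · simp
    · rw [coeff_X_mul, coeff_derivative, monicJacobi_coeff]; push_cast; ring
  simp only [sub_mul, one_mul, finsetSum_coeff, coeff_sub, coeff_C_mul, monicJacobi_coeff, hX,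
    coeff_derivative] at h1 h2
  have h3 : ((n : ℝ) - j) * (n + j + (a + b + 1)) *
        ∑ k ∈ Finset.range n, flowCoeff n k a b da db * monicCoeff k j a (a + b + 1)
      + (j + 1) * (j + 1 + a) *
        ∑ k ∈ Finset.range n, flowCoeff n k a b da db * monicCoeff k (j + 1) a (a + b + 1) =
      db * ∑ k ∈ Finset.range n, eulerCoeff n k a (a + b + 1) * monicCoeff k j a (a + b + 1)
      + da * ∑ k ∈ Finset.range n, (-1) ^ (n - k) * eulerCoeff n k b (a + b + 1)
          * monicCoeff k j a (a + b + 1) := by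
    simp only [Finset.mul_sum]
    rw [← Finset.sum_add_distrib, ← Finset.sum_add_distrib]
    refine Finset.sum_congr rfl fun k hk => ?_
    have hkn : (0 : ℝ) < n - k := by
      rw [sub_pos]; exact_mod_cast Finset.mem_range.mp hk
    have hd : ((n : ℝ) - k) * (n + k + (a + b + 1)) ≠ 0 := by positivity
    have hr := monicCoeff_rec k j a hs
    have hf : flowCoeff n k a b da db * (((n : ℝ) - k) * (n + k + (a + b + 1))) =
        db * eulerCoeff n k a (a + b + 1)
          + da * ((-1) ^ (n - k) * eulerCoeff n k b (a + b + 1)) := by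
      rw [flowCoeff, div_mul_cancel₀ _ hd]
    linear_combination flowCoeff n k a b da db * hr + monicCoeff k j a (a + b + 1) * hf
  rw [h3, ← h1, ← h2]
  ring

/-- Descending induction on `j` from the constant leading coefficient: `monicCoeff_rec` expresses
coefficient `j` through coefficient `j + 1`, and its derivative matches `sum_flowCoeff_mul_rec`. -/
lemma hasDerivAt_monicCoeff (n i : ℕ) (a b da db t : ℝ)
    (ha : -1 < a + da * t) (hb : -1 < b + db * t)
    (hs : 0 < a + da * t + (b + db * t) + 1) (j : ℕ) (hj : j + i = n) :
    HasDerivAt (fun τ => monicCoeff n j (a + da * τ) (a + da * τ + (b + db * τ) + 1))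
      (∑ k ∈ Finset.range n, flowCoeff n k (a + da * t) (b + db * t) da db *
        monicCoeff k j (a + da * t) (a + da * t + (b + db * t) + 1)) t := by
  induction i generalizing j with
  | zero =>
    obtain rfl : j = n := hj
    simp only [monicCoeff_self]
    rw [Finset.sum_eq_zero]
    · exact hasDerivAt_const _ _
    · intro k hk
      rw [monicCoeff_of_lt (Finset.mem_range.mp hk), mul_zero]
  | succ i ih =>
    have ih := ih (j + 1) (by omega)
    have hnj : (0 : ℝ) < n - j := by rw [sub_pos]; exact_mod_cast (by omega : j < n)
    have hrec := sum_flowCoeff_mul_rec n j da db ha hb hs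
    have hda : HasDerivAt (fun τ : ℝ => a + da * τ) da t := by
      simpa using ((hasDerivAt_id t).const_mul da).const_add a
    have hdb : HasDerivAt (fun τ : ℝ => b + db * τ) db t := by
      simpa using ((hasDerivAt_id t).const_mul db).const_add b
    have hds := (hda.add hdb).add_const (1 : ℝ)
    have hsc : ∀ᶠ τ in nhds t, 0 < a + da * τ + (b + db * τ) + 1 :=
      hds.continuousAt.eventually (lt_mem_nhds hs)
    have hq : ((n : ℝ) - j) * (n + j + (a + da * t + (b + db * t) + 1)) ≠ 0 := by positivity
    have hnum := ((hda.const_add ((j : ℝ) + 1)).const_mul (-((j : ℝ) + 1))).mul ih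
    have hden := (hds.const_add ((n : ℝ) + j)).const_mul ((n : ℝ) - j)
    have hdiv := hnum.div hden hq
    refine (hdiv.congr_of_eventuallyEq ?_).congr_deriv ?_
    · filter_upwards [hsc] with τ hτ
      have hr := monicCoeff_rec n j (a + da * τ) hτ
      have : ((n : ℝ) - j) * (n + j + (a + da * τ + (b + db * τ) + 1)) ≠ 0 := by positivity
      simp only [Pi.mul_apply, Pi.div_apply, Pi.add_apply]
      rw [eq_div_iff this]
      linear_combination hr
    · have hr := monicCoeff_rec n j (a + da * t) hs
      simp only [Pi.mul_apply, Pi.add_apply]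
      rw [div_eq_iff (pow_ne_zero 2 hq)]
      linear_combination (-((n : ℝ) - j) * (n + j + (a + da * t + (b + db * t) + 1))) * hrec
        + (n - j) * (da + db) * hr

lemma eval_monicJacobi {k N : ℕ} (h : k < N) (a b z : ℝ) :
    (monicJacobi k a b).eval z =
      ∑ j ∈ Finset.range N, monicCoeff k j a (a + b + 1) * z ^ j := by
  have hd : (monicJacobi k a b).natDegree < N := by
    refine lt_of_le_of_lt (natDegree_le_iff_coeff_eq_zero.mpr fun j hj => ?_) h
    rw [monicJacobi_coeff, monicCoeff_of_lt hj]
  rw [eval_eq_sum_range' hd]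
  simp only [monicJacobi_coeff]

lemma hasDerivAt_eval_monicJacobi (n : ℕ) (a b da db t z : ℝ)
    (ha : -1 < a + da * t) (hb : -1 < b + db * t)
    (hs : 0 < a + da * t + (b + db * t) + 1) :
    HasDerivAt (fun τ => (monicJacobi n (a + da * τ) (b + db * τ)).eval z)
      (∑ k ∈ Finset.range n, flowCoeff n k (a + da * t) (b + db * t) da db *
        (monicJacobi k (a + da * t) (b + db * t)).eval z) t := by
  simp only [eval_monicJacobi n.lt_succ_self]
  have h : HasDerivAt (fun τ => ∑ j ∈ Finset.range (n + 1),
      monicCoeff n j (a + da * τ) (a + da * τ + (b + db * τ) + 1) * z ^ j) _ t :=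
    HasDerivAt.fun_sum fun j hj => (hasDerivAt_monicCoeff n (n - j) a b da db t ha hb hs j
      (by have := Finset.mem_range.mp hj; omega)).mul_const (z ^ j)
  refine h.congr_deriv ?_
  simp only [Finset.sum_mul]
  rw [Finset.sum_comm]
  refine Finset.sum_congr rfl fun k hk => ?_
  rw [eval_monicJacobi (Nat.lt_succ_of_lt (Finset.mem_range.mp hk)), Finset.mul_sum]
  exact Finset.sum_congr rfl fun j _ => by ring

/-- The derivative of the signed quantity for `n` is a nonnegative combination of those for `k < n`,
so strong induction makes it nondecreasing. The induction must cover all times at once. -/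
lemma monicJacobi_flow_nonneg {a b da db w z : ℝ}
    (hab : ∀ τ, 0 ≤ τ → -1 < a + da * τ ∧ -1 < b + db * τ ∧ 0 < a + da * τ + (b + db * τ) + 1)
    (hf : ∀ τ, 0 ≤ τ → ∀ n k, k < n →
      0 ≤ (-1) ^ (n - k) * flowCoeff n k (a + da * τ) (b + db * τ) da db)
    (h0 : ∀ n, 0 ≤ (-1) ^ n * ((monicJacobi n a b).eval 0 + w * (monicJacobi n a b).eval z))
    (n : ℕ) (t : ℝ) (ht : 0 ≤ t) :
    0 ≤ (-1) ^ n * ((monicJacobi n (a + da * t) (b + db * t)).eval 0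
      + w * (monicJacobi n (a + da * t) (b + db * t)).eval z) := by
  induction n using Nat.strong_induction_on generalizing t with
  | _ n ih =>
    set D : ℕ → ℝ → ℝ := fun n t => (-1) ^ n * ((monicJacobi n (a + da * t) (b + db * t)).eval 0
      + w * (monicJacobi n (a + da * t) (b + db * t)).eval z) with hD
    have hder : ∀ τ, 0 ≤ τ → HasDerivAt (D n) (∑ k ∈ Finset.range n,
        ((-1) ^ (n - k) * flowCoeff n k (a + da * τ) (b + db * τ) da db) * D k τ) τ := by
      intro τ hτ
      obtain ⟨ha, hb, hs⟩ := hab τ hτ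
      refine (((hasDerivAt_eval_monicJacobi n a b da db τ 0 ha hb hs).add
        ((hasDerivAt_eval_monicJacobi n a b da db τ z ha hb hs).const_mul w)).const_mul
          ((-1) ^ n)).congr_deriv ?_
      rw [Finset.mul_sum, ← Finset.sum_add_distrib, Finset.mul_sum]
      refine Finset.sum_congr rfl fun k hk => ?_
      obtain ⟨i, rfl⟩ := Nat.exists_eq_add_of_lt (Finset.mem_range.mp hk)
      have e1 : k + i + 1 - k = i + 1 := by omega
      have hk2 : ((-1 : ℝ)) ^ (k + i + 1) = (-1) ^ (i + 1) * (-1) ^ k := by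
        rw [← pow_add]; congr 1; omega
      simp only [hD, e1, hk2]
      ring
    have hmono : MonotoneOn (D n) (Set.Ici 0) := by
      refine monotoneOn_of_deriv_nonneg (convex_Ici 0)
        (fun τ hτ => (hder τ hτ).continuousAt.continuousWithinAt)
        (fun τ hτ => (hder τ (interior_subset hτ)).differentiableAt.differentiableWithinAt) ?_
      intro τ hτ
      have hτ : 0 ≤ τ := interior_subset hτ
      rw [(hder τ hτ).deriv]
      refine Finset.sum_nonneg fun k hk => ?_
      have hk := Finset.mem_range.mp hk
      exact mul_nonneg (hf τ hτ n k hk) (ih k hk τ hτ)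
    have h1 := hmono (Set.mem_Ici.mpr le_rfl) (Set.mem_Ici.mpr ht) ht
    refine le_trans ?_ h1
    simpa [hD] using h0 n

lemma neg_one_pow_mul_flowCoeff_nonneg {n k : ℕ} (h : k < n) {a b da db : ℝ} (ha : -1 < a)
    (hb : -1 < b) (hs : 0 < a + b + 1) (hdb : 0 ≤ db) (hd : db ≤ da) (hab : db = 0 ∨ a ≤ b) :
    0 ≤ (-1) ^ (n - k) * flowCoeff n k a b da db := by
  have hkn : (0 : ℝ) < n - k := by rw [sub_pos]; exact_mod_cast h
  have e : (-1) ^ (n - k) * flowCoeff n k a b da db =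
      (((-1) ^ (n - k) * (-1) ^ (n - k)) * (da * eulerCoeff n k b (a + b + 1))
        + (-1) ^ (n - k) * (db * eulerCoeff n k a (a + b + 1)))
        / ((n - k) * (n + k + (a + b + 1))) := by
    rw [flowCoeff]; ring
  have h1 : ((-1 : ℝ) ^ (n - k)) * (-1) ^ (n - k) = 1 := by rw [← mul_pow]; simp
  rw [e, h1, one_mul]
  refine div_nonneg ?_ (by positivity)
  have ea := eulerCoeff_nonneg n k ha hs
  have eb := eulerCoeff_nonneg n k hb hs
  have key : db * eulerCoeff n k a (a + b + 1) ≤ da * eulerCoeff n k b (a + b + 1) := by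
    rcases hab with rfl | hab
    · rw [zero_mul]; positivity
    · have := eulerCoeff_mono n k ha hab hs
      have := hdb.trans hd
      gcongr
  have hx : 0 ≤ db * eulerCoeff n k a (a + b + 1) := by positivity
  -- The `da` term is always positive after the sign change and, by `key`, dominates the `db` term
  -- whichever sign that carries.
  rcases neg_one_pow_eq_or ℝ (n - k) with h | h <;> rw [h] <;> linarith

/-! ### Rotations of binary forms and the integer base case -/

/-- The images of the monomials of degree `N` under the linear substitution with matrix
`!![A, B; -B, A]`, dehomogenized. -/
noncomputable def rotatedMonomial (A B : ℝ) (N n : ℕ) : ℝ[X] :=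
  (C A * X + C B) ^ n * (C (-B) * X + C A) ^ (N - n)

lemma coeff_linear_pow (p q : ℝ) (N k : ℕ) :
    ((C p * X + C q) ^ N).coeff k = N.choose k * p ^ k * q ^ (N - k) := by
  rw [add_pow, finsetSum_coeff]
  have h : ∀ i, ((C p * X) ^ i * C q ^ (N - i) * ((N.choose i : ℕ) : ℝ[X])).coeff k =
      if k = i then N.choose i * p ^ i * q ^ (N - i) else 0 := by
    intro i
    have : (C p * X) ^ i * C q ^ (N - i) * ((N.choose i : ℕ) : ℝ[X]) =
        C (N.choose i * p ^ i * q ^ (N - i)) * X ^ i := by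
      simp only [C_mul, C_pow, mul_pow, map_natCast]; ring
    rw [this, coeff_C_mul, coeff_X_pow]
    simp
  simp only [h, Finset.sum_ite_eq, Finset.mem_range]
  split_ifs with hk
  · rfl
  · rw [Nat.choose_eq_zero_of_lt (by omega)]; simp

lemma natDegree_rotatedMonomial_le (A B : ℝ) {N n : ℕ} (h : n ≤ N) :
    (rotatedMonomial A B N n).natDegree ≤ N := by
  refine natDegree_mul_le.trans ?_
  have h1 : ((C A * X + C B) ^ n).natDegree ≤ n :=
    natDegree_le_iff_coeff_eq_zero.mpr fun k hk => by
      rw [coeff_linear_pow, Nat.choose_eq_zero_of_lt hk]; simp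
  have h2 : ((C (-B) * X + C A) ^ (N - n)).natDegree ≤ N - n :=
    natDegree_le_iff_coeff_eq_zero.mpr fun k hk => by
      rw [coeff_linear_pow, Nat.choose_eq_zero_of_lt hk]; simp
  omega

lemma eval_rotatedMonomial (A B : ℝ) {N n : ℕ} (h : n ≤ N) (x : ℝ) :
    (rotatedMonomial A B N n).eval x =
      ∑ j ∈ Finset.range (N + 1), (rotatedMonomial A B N n).coeff j * x ^ j :=
  eval_eq_sum_range' (Nat.lt_succ_of_le (natDegree_rotatedMonomial_le A B h)) x

lemma sum_coeff_mul_rotatedMonomial {A B : ℝ} (hAB : A ^ 2 + B ^ 2 = 1) {N n : ℕ} (h : n ≤ N) :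
    ∑ j ∈ Finset.range (N + 1),
      C ((rotatedMonomial A B N n).coeff j) * rotatedMonomial A (-B) N j = X ^ n := by
  refine eq_of_infinite_eval_eq _ _ (Set.Infinite.mono (s := {u | A + B * u = 0}ᶜ) ?_ ?_)
  · intro u hu
    have hu : A + B * u ≠ 0 := hu
    -- The inverse rotation acts on the dehomogenized variable as this Möbius map; its single
    -- possible pole is excluded from the test set.
    set v := (A * u - B) / (A + B * u) with hv
    have h1 : ∀ j ∈ Finset.range (N + 1),
        (C ((rotatedMonomial A B N n).coeff j) * rotatedMonomial A (-B) N j).eval u =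
          (A + B * u) ^ N * ((rotatedMonomial A B N n).coeff j * v ^ j) := by
      intro j hj
      obtain ⟨i, rfl⟩ := Nat.exists_eq_add_of_le (Nat.lt_succ_iff.mp (Finset.mem_range.mp hj))
      simp only [rotatedMonomial, Nat.add_sub_cancel_left, eval_mul, eval_C, eval_pow, eval_add,
        eval_X, hv, div_pow, pow_add]
      field_simp
      ring
    simp only [Set.mem_ofPred_eq, eval_finsetSum, eval_pow, eval_X]
    rw [Finset.sum_congr rfl h1, ← Finset.mul_sum, ← eval_rotatedMonomial A B h]
    obtain ⟨i, rfl⟩ := Nat.exists_eq_add_of_le h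
    have hv' : v * (A + B * u) = A * u - B := div_mul_cancel₀ _ hu
    have e1 : A * v + B = u / (A + B * u) := by
      rw [eq_div_iff hu]; linear_combination A * hv' + u * hAB
    have e2 : -B * v + A = 1 / (A + B * u) := by
      rw [eq_div_iff hu]; linear_combination -B * hv' + hAB
    simp only [rotatedMonomial, Nat.add_sub_cancel_left, eval_mul, eval_C, eval_pow, eval_add,
      eval_X, e1, e2, div_pow, pow_add, one_pow]
    field_simp
  · refine Set.Finite.infinite_compl ((Set.finite_singleton (-A / B)).subset fun u hu => ?_)
    have hu : A + B * u = 0 := hu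
    have hB : B ≠ 0 := by
      rintro rfl
      have : A = 0 := by linarith
      simp [this] at hAB
    rw [Set.mem_singleton_iff, eq_div_iff hB]
    linarith

/-- Both sides are coefficients of the generating function `(y (A x + B) + (-B x + A))^N`, which is
invariant under exchanging `x` and `y` together with `B ↦ -B`. -/
lemma choose_mul_coeff_rotatedMonomial (A B : ℝ) {N n j : ℕ} (hn : n ≤ N) (hj : j ≤ N) :
    N.choose n * (rotatedMonomial A B N n).coeff j =
      N.choose j * (rotatedMonomial A (-B) N j).coeff n := by
  have hgen : ∀ (B x y : ℝ), ∑ k ∈ Finset.range (N + 1),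
      N.choose k * y ^ k * (rotatedMonomial A B N k).eval x
        = (y * (A * x + B) + (-B * x + A)) ^ N := by
    intro B x y
    rw [add_pow]
    refine Finset.sum_congr rfl fun k _ => ?_
    simp only [rotatedMonomial, eval_mul, eval_C, eval_pow, eval_add, eval_X, mul_pow]
    ring
  have h1 : ∀ x : ℝ, ∑ k ∈ Finset.range (N + 1),
      C (N.choose k * (rotatedMonomial A B N k).eval x) * X ^ k =
        ∑ k ∈ Finset.range (N + 1), C (N.choose k * x ^ k) * rotatedMonomial A (-B) N k := by
    intro x
    refine Polynomial.funext fun y => ?_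
    simp only [eval_finsetSum, eval_mul, eval_C, eval_pow, eval_X]
    rw [hgen (-B) y x]
    calc _ = ∑ k ∈ Finset.range (N + 1),
          N.choose k * y ^ k * (rotatedMonomial A B N k).eval x :=
          Finset.sum_congr rfl fun k _ => by ring
      _ = _ := by rw [hgen B x y]; ring
  have h2 : C (N.choose n : ℝ) * rotatedMonomial A B N n = ∑ k ∈ Finset.range (N + 1),
      C (N.choose k * (rotatedMonomial A (-B) N k).coeff n) * X ^ k := by
    refine Polynomial.funext fun x => ?_
    have h := congrArg (fun p => p.coeff n) (h1 x)
    simp only [finsetSum_coeff, coeff_C_mul, coeff_X_pow, mul_ite, mul_one, mul_zero,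
      Finset.sum_ite_eq, Finset.mem_range, Nat.lt_succ_iff, hn, if_true] at h
    simp only [eval_finsetSum, eval_mul, eval_C, eval_pow, eval_X]
    rw [h]
    exact Finset.sum_congr rfl fun k _ => by ring
  have h := congrArg (fun p => p.coeff j) h2
  simpa only [finsetSum_coeff, coeff_C_mul, coeff_X_pow, mul_ite, mul_one, mul_zero,
      Finset.sum_ite_eq, Finset.mem_range, Nat.lt_succ_iff, hj, if_true] using h

/-- Rotation followed by its inverse is the identity; by the symmetry above its diagonal entry is a
weighted sum of squares equal to 1, in which the `j = n` term has weight 1. -/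
lemma abs_coeff_rotatedMonomial_le_one {A B : ℝ} (hAB : A ^ 2 + B ^ 2 = 1) {N n : ℕ}
    (hn : n ≤ N) : |(rotatedMonomial A B N n).coeff n| ≤ 1 := by
  have h := congrArg (fun p => p.coeff n) (sum_coeff_mul_rotatedMonomial hAB hn)
  simp only [finsetSum_coeff, coeff_C_mul, coeff_X_pow_self] at h
  have hpos : ∀ j, j ≤ N → (0 : ℝ) < N.choose j := fun j hj => by
    exact_mod_cast Nat.choose_pos hj
  have h1 : ∀ j ∈ Finset.range (N + 1),
      (rotatedMonomial A B N n).coeff j * (rotatedMonomial A (-B) N j).coeff n =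
        (rotatedMonomial A B N n).coeff j ^ 2 * (N.choose n / N.choose j) := by
    intro j hj
    have hj := Nat.lt_succ_iff.mp (Finset.mem_range.mp hj)
    have := choose_mul_coeff_rotatedMonomial A B hn hj
    have hp := hpos j hj
    field_simp
    linear_combination -(rotatedMonomial A B N n).coeff j * this
  rw [Finset.sum_congr rfl h1] at h
  have h2 := Finset.single_le_sum (f := fun j =>
    (rotatedMonomial A B N n).coeff j ^ 2 * ((N.choose n : ℝ) / N.choose j))
    (fun j _ => by positivity) (Finset.mem_range.mpr (Nat.lt_succ_of_le hn))
  rw [h] at h2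
  simp only [div_self (hpos n hn).ne', mul_one] at h2
  exact (sq_le_one_iff_abs_le_one _).mp h2

lemma bernsteinCoeff_zero_natCast (k l m : ℕ) :
    bernsteinCoeff (k + l) k 0 m =
      (-1) ^ k * (k + l).factorial * (k + l).choose k * (k + l + m).choose k := by
  have h1 := rising_natCast_succ k l
  have h2 := rising_natCast_succ (m + l) k
  have hc : ((k + l + m).choose k : ℝ) * (k.factorial * (m + l).factorial) =
      (m + l + k).factorial := by
    have h := Nat.choose_mul_factorial_mul_factorial (n := k + l + m) (k := k) (by omega)
    have e : k + l + m - k = m + l := by omega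
    rw [e] at h
    have e' : m + l + k = k + l + m := by ring
    rw [e', ← h]; push_cast; ring
  have e3 : (m : ℝ) + (l : ℝ) + 1 = ((m + l : ℕ) : ℝ) + 1 := by push_cast; ring
  rw [bernsteinCoeff, Nat.add_sub_cancel_left, zero_add, e3]
  have p1 : (k.factorial : ℝ) ≠ 0 := by positivity
  have p2 : ((m + l).factorial : ℝ) ≠ 0 := by positivity
  refine mul_right_cancel₀ (mul_ne_zero p1 p2) ?_
  linear_combination (-1 : ℝ) ^ k * (k + l).choose k * (rising ((m + l : ℕ) + 1) k
    * (m + l).factorial * h1 + (k + l).factorial * h2 - (k + l).factorial * hc)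

lemma pow_mul_abs_bernsteinJacobi_le (n m : ℕ) {A B : ℝ} (hA : 0 ≤ A)
    (hAB : A ^ 2 + B ^ 2 = 1) :
    A ^ m * |(bernsteinJacobi n 0 m).eval (B ^ 2)| ≤ n.factorial := by
  have h := abs_coeff_rotatedMonomial_le_one hAB (Nat.le_add_right n (n + m))
  have key : A ^ m * (bernsteinJacobi n 0 m).eval (B ^ 2) =
      n.factorial * (rotatedMonomial A B (n + (n + m)) n).coeff n := by
    -- The factor of degree `n + m` is put first so that its index in the convolution is the
    -- Bernstein index `k`.
    rw [rotatedMonomial, mul_comm (_ ^ n), coeff_mul, Nat.add_sub_cancel_left]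
    simp only [coeff_linear_pow]
    rw [Finset.Nat.sum_antidiagonal_eq_sum_range_succ (fun i j =>
      ((n + m).choose i * (-B) ^ i * A ^ (n + m - i)) * (n.choose j * A ^ j * B ^ (n - j)))]
    rw [bernsteinJacobi, eval_finsetSum, Finset.mul_sum, Finset.mul_sum]
    refine Finset.sum_congr rfl fun k hk => ?_
    obtain ⟨l, rfl⟩ := Nat.exists_eq_add_of_le (Nat.lt_succ_iff.mp (Finset.mem_range.mp hk))
    have e2 : k + l - k = l := by omega
    have e3 : k + l + m - k = l + m := by omega
    have e4 : k + l - l = k := by omega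
    have e5 : 1 - B ^ 2 = A ^ 2 := by linear_combination -hAB
    simp only [e2, e3, e4, bernsteinCoeff_zero_natCast, eval_mul, eval_C, eval_pow, eval_X,
      eval_sub, eval_one, e5]
    rw [neg_pow B, pow_add A, ← Nat.choose_symm_add (a := k) (b := l)]
    ring
  have h3 : A ^ m * |(bernsteinJacobi n 0 m).eval (B ^ 2)| =
      n.factorial * |(rotatedMonomial A B (n + (n + m)) n).coeff n| := by
    have := congrArg abs key
    rwa [abs_mul, abs_mul, abs_of_nonneg (pow_nonneg hA m), Nat.abs_cast] at this
  rw [h3]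
  exact mul_le_of_le_one_right (by positivity) h

/-! ### Terminating hypergeometric sums: Jacobi and Meixner in Bernstein form -/

lemma rising_neg (x : ℝ) (k : ℕ) : rising (-x) k = (-1) ^ k * rising (x - k + 1) k := by
  induction k with
  | zero => simp
  | succ k ih =>
    rw [rising_succ, ih, rising_succ_left, pow_succ]
    have e : x - ((k + 1 : ℕ) : ℝ) + 1 = x - k := by push_cast; ring
    rw [e]
    ring

lemma rising_neg_natCast {n k : ℕ} (h : k ≤ n) :
    rising (-(n : ℝ)) k = (-1) ^ k * (n.choose k * k.factorial) := by
  obtain ⟨l, rfl⟩ := Nat.exists_eq_add_of_le h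
  have h1 := rising_natCast_succ l k
  have h2 := Nat.choose_mul_factorial_mul_factorial h
  rw [Nat.add_sub_cancel_left] at h2
  have h3 : (((k + l).choose k : ℝ) * k.factorial) * l.factorial = (k + l).factorial := by
    exact_mod_cast h2
  have e : ((k + l : ℕ) : ℝ) - k + 1 = l + 1 := by push_cast; ring
  rw [rising_neg, e]
  congr 1
  refine mul_right_cancel₀ (b := (l.factorial : ℝ)) (by positivity) ?_
  rw [h1, h3, add_comm]

lemma ordinaryHypergeometric_neg_natCast (n : ℕ) (b c z : ℝ) :
    ordinaryHypergeometric (-(n : ℝ)) b c z = ∑ k ∈ Finset.range (n + 1),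
      (-1) ^ k * n.choose k * rising b k / rising c k * z ^ k := by
  rw [ordinaryHypergeometric, ordinaryHypergeometric_sum_eq, tsum_eq_sum (s := Finset.range (n + 1))]
  · refine Finset.sum_congr rfl fun k hk => ?_
    have h := rising_neg_natCast (Nat.lt_succ_iff.mp (Finset.mem_range.mp hk))
    unfold rising at *
    rw [h, smul_eq_mul]
    have : (k.factorial : ℝ) ≠ 0 := by positivity
    field_simp
  · intro k hk
    have hk : n < k := by simpa [Nat.lt_succ_iff] using hk
    rw [ascPochhammer_eval_neg_coe_nat_of_lt hk]
    simp

lemma shiftedBinomial_eq (n : ℕ) (a : ℝ) :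
    shiftedBinomial n a = rising (a + 1) n / n.factorial := rfl

lemma shiftedBinomial_pos (n : ℕ) {a : ℝ} (ha : -1 < a) : 0 < shiftedBinomial n a := by
  rw [shiftedBinomial_eq]
  have := rising_pos (x := a + 1) (by linarith) n
  positivity

lemma jacobiP_eq (n : ℕ) {a b : ℝ} (ha : -1 < a) (hs : 0 < a + b + 1) (x : ℝ) :
    jacobiP n a b x = (bernsteinJacobi n a b).eval ((1 - x) / 2) / n.factorial := by
  rw [jacobiP, shiftedBinomial_eq, ordinaryHypergeometric_neg_natCast, bernsteinJacobi_eq n ha hs,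
    eval_mul, eval_C, eval_monicJacobi n.lt_succ_self, div_mul_eq_mul_div, Finset.mul_sum,
    Finset.mul_sum]
  congr 1
  refine Finset.sum_congr rfl fun k hk => ?_
  obtain ⟨l, rfl⟩ := Nat.exists_eq_add_of_le (Nat.lt_succ_iff.mp (Finset.mem_range.mp hk))
  have e1 : a + 1 + k = a + k + 1 := by ring
  have e2 : ((k + l : ℕ) : ℝ) + a + b + 1 = (k + l : ℕ) + (a + b + 1) := by ring
  rw [monicCoeff, Nat.add_sub_cancel_left, rising_add (a + 1), e1, e2,
    rising_add ((k + l : ℕ) + (a + b + 1))]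
  have h1 := rising_pos (x := a + 1) (by linarith) k
  have h2 := rising_pos (x := (k + l : ℕ) + (a + b + 1) + k) (by positivity) l
  have h3 : ((-1 : ℝ) ^ l) * (-1) ^ l = 1 := by rw [← mul_pow]; simp
  rw [pow_add]
  field_simp
  linear_combination -(rising (a + k + 1) l * (k + l).choose k *
    rising ((k + l : ℕ) + (a + b + 1)) k * ((1 - x) / 2) ^ k) * h3

lemma meixnerM_eq (n : ℕ) {a : ℝ} (b : ℝ) {c : ℝ} (ha : -1 < a) (hc : c ≠ 0) :
    rising (a + 1) n * (c ^ n * meixnerM n (n + b) (a + 1) c) =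
      (bernsteinJacobi n a b).eval (1 - c) := by
  rw [meixnerM, ordinaryHypergeometric_neg_natCast, bernsteinJacobi, eval_finsetSum,
    Finset.mul_sum, Finset.mul_sum]
  refine Finset.sum_congr rfl fun k hk => ?_
  obtain ⟨l, rfl⟩ := Nat.exists_eq_add_of_le (Nat.lt_succ_iff.mp (Finset.mem_range.mp hk))
  have e1 : a + 1 + k = a + k + 1 := by ring
  have e2 : ((k + l : ℕ) : ℝ) + b - k + 1 = b + l + 1 := by push_cast; ring
  have e3 : 1 - c⁻¹ = -((1 - c) / c) := by field_simp; ring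
  rw [bernsteinCoeff, Nat.add_sub_cancel_left, rising_add (a + 1), e1, rising_neg, e2, e3,
    neg_pow ((1 - c) / c), div_pow]
  have h1 := rising_pos (x := a + 1) (by linarith) k
  have h3 : ((-1 : ℝ) ^ k) * (-1) ^ k = 1 := by rw [← mul_pow]; simp
  simp only [eval_mul, eval_C, eval_pow, eval_X, eval_sub, eval_one, sub_sub_cancel, pow_add]
  field_simp
  linear_combination (rising (a + k + 1) l * (k + l).choose k * rising (b + l + 1) k *
    (1 - c) ^ k) * h3

/-! ### The inequalities and their equivalence -/

/-- The Jacobi inequality with weight exponent `m / 2`, for `β = m + t` and `0 ≤ t ≤ α`. -/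
lemma pow_mul_abs_bernsteinJacobi_le_rising (n m : ℕ) {a t A z : ℝ} (ht : 0 ≤ t) (hta : t ≤ a)
    (hA : 0 ≤ A) (hz : 0 ≤ z) (hAz : A ^ 2 + z = 1) :
    A ^ m * |(bernsteinJacobi n a (m + t)).eval z| ≤ rising (a + 1) n := by
  have hm : (0 : ℝ) ≤ m := m.cast_nonneg
  have hJ : ∀ (n : ℕ) {a b : ℝ} (y : ℝ), 0 ≤ a → 0 ≤ b →
      (-1) ^ n * (monicJacobi n a b).eval y =
        (bernsteinJacobi n a b).eval y / rising (n + (a + b + 1)) n := by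
    intro n a b y ha hb
    have h1 := rising_pos (x := n + (a + b + 1)) (by positivity) n
    rw [bernsteinJacobi_eq n (by linarith) (by linarith), eval_mul, eval_C]
    field_simp
  have h0 : ∀ (n : ℕ) (a b : ℝ), (bernsteinJacobi n a b).eval 0 = rising (a + 1) n := fun n a b => by
    rw [← coeff_zero_eq_eval_zero, bernsteinJacobi_coeff_zero]
  have key : ∀ w : ℝ, |w| = A ^ m → ∀ n : ℕ, 0 ≤ (-1) ^ n *
      ((monicJacobi n a (m + t)).eval 0 + w * (monicJacobi n a (m + t)).eval z) := by
    intro w hw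
    have base : ∀ n : ℕ, 0 ≤ (-1) ^ n *
        ((monicJacobi n 0 m).eval 0 + w * (monicJacobi n 0 m).eval z) := by
      intro n
      have hB : A ^ 2 + √z ^ 2 = 1 := by rw [Real.sq_sqrt hz, hAz]
      have h := pow_mul_abs_bernsteinJacobi_le n m hA hB
      rw [Real.sq_sqrt hz, ← hw, ← abs_mul] at h
      have h1 := rising_pos (x := n + ((0 : ℝ) + m + 1)) (by positivity) n
      have hr : rising ((0 : ℝ) + 1) n = n.factorial := by
        have := rising_natCast_succ 0 n
        simpa using this
      rw [mul_add, mul_left_comm, hJ n 0 le_rfl hm, hJ n z le_rfl hm, h0, hr, ← mul_div_assoc,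
        ← add_div]
      have := neg_abs_le (w * (bernsteinJacobi n 0 m).eval z)
      exact div_nonneg (by linarith) h1.le
    -- On the diagonal path `(τ, m + τ)` the first parameter never exceeds the second, as the sign
    -- condition requires.
    have diag := fun n => monicJacobi_flow_nonneg (a := 0) (b := m) (da := 1) (db := 1)
      (fun τ hτ => ⟨by linarith, by linarith, by linarith⟩)
      (fun τ hτ n k hk => neg_one_pow_mul_flowCoeff_nonneg hk (by linarith) (by linarith)
        (by linarith) zero_le_one le_rfl (Or.inr (by linarith))) base n t ht
    simp only [zero_add, one_mul] at diag
    intro n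
    have h := monicJacobi_flow_nonneg (a := t) (b := m + t) (da := 1) (db := 0)
      (fun τ hτ => ⟨by linarith, by linarith, by linarith⟩)
      (fun τ hτ n k hk => neg_one_pow_mul_flowCoeff_nonneg hk (by linarith) (by linarith)
        (by linarith) le_rfl zero_le_one (Or.inl rfl)) diag n (a - t) (by linarith)
    simpa using h
  have ha : 0 ≤ a := ht.trans hta
  have hb : 0 ≤ m + t := by positivity
  have h1 := rising_pos (x := n + (a + (m + t) + 1)) (by positivity) n
  have fin : ∀ w : ℝ, |w| = A ^ m →
      0 ≤ rising (a + 1) n + w * (bernsteinJacobi n a (m + t)).eval z := by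
    intro w hw
    have h := key w hw n
    rw [mul_add, mul_left_comm, hJ n 0 ha hb, hJ n z ha hb, h0, ← mul_div_assoc, ← add_div] at h
    simpa using (le_div_iff₀ h1).mp h
  have hAm : 0 ≤ A ^ m := by positivity
  have f1 := fin (A ^ m) (abs_of_nonneg hAm)
  have f2 := fin (-A ^ m) (by rw [abs_neg, abs_of_nonneg hAm])
  rw [← abs_of_nonneg hAm, ← abs_mul, abs_le]
  constructor <;> linarith

lemma rpow_mul_abs_jacobiP_le (n : ℕ) {a b : ℝ} (hb : 0 ≤ b) (hab : b - (⌊b⌋ : ℝ) ≤ a) {x : ℝ}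
    (hx : x ∈ Set.Icc (-1 : ℝ) 1) :
    ((1 + x) / 2) ^ (b / 2) * |jacobiP n a b x| ≤ shiftedBinomial n a := by
  have ht : 0 ≤ b - (⌊b⌋ : ℝ) := Int.fract_nonneg b
  have ha : 0 ≤ a := ht.trans hab
  have hm : ((⌊b⌋₊ : ℕ) : ℝ) = (⌊b⌋ : ℝ) := by
    exact_mod_cast congrArg (Int.cast (R := ℝ)) (Int.natCast_floor_eq_floor hb)
  have hy0 : 0 ≤ (1 + x) / 2 := by linarith [hx.1]
  have hy1 : (1 + x) / 2 ≤ 1 := by linarith [hx.2]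
  have h := pow_mul_abs_bernsteinJacobi_le_rising n ⌊b⌋₊ ht hab (Real.sqrt_nonneg ((1 + x) / 2))
    (z := (1 - x) / 2) (by linarith [hx.2]) (by rw [Real.sq_sqrt hy0]; ring)
  rw [hm, add_sub_cancel] at h
  rw [jacobiP_eq n (by linarith) (by linarith), shiftedBinomial_eq, abs_div, Nat.abs_cast,
    ← mul_div_assoc]
  refine div_le_div_of_nonneg_right (le_trans ?_ h) (by positivity)
  gcongr
  rw [← Real.rpow_natCast, Real.sqrt_eq_rpow, ← Real.rpow_mul hy0]
  -- For a base in `(0, 1]` the exponent `b / 2 ≥ ⌊b⌋ / 2` gives the smaller weight. Base 0 is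
  -- separate: `b = 0` gives `0 ^ 0 = 1` on both sides.
  rcases hy0.eq_or_lt with h0 | h0
  · rw [← h0]
    rcases hb.eq_or_lt with rfl | hb
    · simp
    · rw [Real.zero_rpow (by positivity)]; positivity
  · refine Real.rpow_le_rpow_of_exponent_ge h0 hy1 ?_
    rw [hm]
    linarith

lemma shiftedBinomial_mul_abs_meixnerM (n : ℕ) {a b c : ℝ} (ha : -1 < a) (hs : 0 < a + b + 1)
    (hc : 0 < c) :
    shiftedBinomial n a * (c ^ (((n : ℝ) + (n + b)) / 2) * |meixnerM n (n + b) (a + 1) c|) =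
      c ^ (b / 2) * |jacobiP n a b (2 * c - 1)| := by
  have h := meixnerM_eq n b ha hc.ne'
  have e : (1 - (2 * c - 1)) / 2 = 1 - c := by ring
  have e2 : ((n : ℝ) + (n + b)) / 2 = n + b / 2 := by ring
  have hr := rising_pos (x := a + 1) (by linarith) n
  rw [jacobiP_eq n ha hs, e, ← h, shiftedBinomial_eq, e2, Real.rpow_add hc, Real.rpow_natCast,
    abs_div, abs_mul, abs_mul, Nat.abs_cast, abs_of_pos hr, abs_of_pos (pow_pos hc n)]
  ring

lemma jacobi_inequality_iff_meixner (n : ℕ) {a b : ℝ} (ha : -1 < a) (hb : 0 ≤ b) :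
    (∀ x ∈ Set.Icc (-1 : ℝ) 1, ((1 + x) / 2) ^ (b / 2) * |jacobiP n a b x| ≤ shiftedBinomial n a) ↔
      ∀ c ∈ Set.Ioo (0 : ℝ) 1,
        c ^ (((n : ℝ) + (n + b)) / 2) * |meixnerM n (n + b) (a + 1) c| ≤ 1 := by
  have hs : 0 < a + b + 1 := by linarith
  have hbin := shiftedBinomial_pos n ha
  have key : ∀ c, 0 < c → (((1 + (2 * c - 1)) / 2) ^ (b / 2) * |jacobiP n a b (2 * c - 1)| ≤
      shiftedBinomial n a ↔ c ^ (((n : ℝ) + (n + b)) / 2) * |meixnerM n (n + b) (a + 1) c| ≤ 1) := by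
    intro c hc
    have e : (1 + (2 * c - 1)) / 2 = c := by ring
    rw [e, ← shiftedBinomial_mul_abs_meixnerM n ha hs hc, mul_le_iff_le_one_right hbin]
  constructor
  · intro h c hc
    exact (key c hc.1).mp (h _ ⟨by linarith [hc.1], by linarith [hc.2]⟩)
  · intro h
    -- The range `0 < c < 1` covers only the open interval; the endpoints follow by continuity,
    -- where `b ≥ 0` keeps the weight continuous at `x = -1`.
    have hopen : Set.Ioo (-1 : ℝ) 1 ⊆ {x | ((1 + x) / 2) ^ (b / 2) * |jacobiP n a b x| ≤
        shiftedBinomial n a} := by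
      intro x hx
      have h1 := (key ((1 + x) / 2) (by linarith [hx.1])).mpr
        (h _ ⟨by linarith [hx.1], by linarith [hx.2]⟩)
      have e : 2 * ((1 + x) / 2) - 1 = x := by ring
      rwa [e] at h1
    have hcont : Continuous fun x => ((1 + x) / 2) ^ (b / 2) * |jacobiP n a b x| := by
      simp only [jacobiP_eq n ha hs]
      refine Continuous.mul ?_ (by fun_prop)
      exact Continuous.rpow_const (by fun_prop) fun _ => Or.inr (by positivity)
    have hcl := closure_minimal hopen (isClosed_le hcont continuous_const)
    rw [closure_Ioo (by norm_num)] at hcl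
    exact hcl

theorem theorem5p1 :
    (∀ (n : ℕ) (α β : ℝ), 0 ≤ β → β - (⌊β⌋ : ℝ) ≤ α →
      ∀ x ∈ Set.Icc (-1 : ℝ) 1,
        ((1 + x) / 2) ^ (β / 2) * |jacobiP n α β x| ≤ shiftedBinomial n α) ∧
    (∀ (n : ℕ) (x β c : ℝ), (n : ℝ) ≤ x → 0 < c → c < 1 → x - (⌊x⌋ : ℝ) + 1 ≤ β →
      c ^ (((n : ℝ) + x) / 2) * |meixnerM n x β c| ≤ 1) ∧
    (∀ (n : ℕ) (α β : ℝ), -1 < α → 0 ≤ β →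
      ((∀ x ∈ Set.Icc (-1 : ℝ) 1,
          ((1 + x) / 2) ^ (β / 2) * |jacobiP n α β x| ≤ shiftedBinomial n α) ↔
        (∀ c ∈ Set.Ioo (0 : ℝ) 1,
          c ^ (((n : ℝ) + ((n : ℝ) + β)) / 2) * |meixnerM n ((n : ℝ) + β) (α + 1) c| ≤ 1))) := by
  refine ⟨fun n α β hβ hα x hx => rpow_mul_abs_jacobiP_le n hβ hα hx, ?_,
    fun n α β hα hβ => jacobi_inequality_iff_meixner n hα hβ⟩
  intro n x β c hx hc0 hc1 hβ
  have hfl : (⌊x - n⌋ : ℝ) = ⌊x⌋ - n := by rw [Int.floor_sub_natCast]; push_cast; rfl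
  have hfr : 0 ≤ x - (⌊x⌋ : ℝ) := Int.fract_nonneg x
  -- Subtracting the integer `n` leaves the fractional part of `x` unchanged, so the hypothesis on
  -- `β` is exactly the Jacobi condition for `(β - 1, x - n)`.
  have h := (jacobi_inequality_iff_meixner n (a := β - 1) (b := x - n) (by linarith)
    (by linarith)).mp (fun y hy => rpow_mul_abs_jacobiP_le n (by linarith)
      (by rw [hfl]; linarith) hy) c ⟨hc0, hc1⟩
  simpa using h
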